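/- For an integer $n\ge 1$ let $x_{k,n}=2k/n-1$, $k=0,\dots,n$, and for $f:[-1,1]\to\mathbb R$ let $B_n(f,\cdot)$ be Berrut's interpolant at these nodes, $$B_n(f,x)=\frac{1}{D_n(x)}\sum_{k=0}^n\frac{(-1)^k f(x_{k,n})}{x-x_{k,n}},\qquad D_n(x)=\sum_{k=0}^n\frac{(-1)^k}{x-x_{k,n}},\qquad x\notin\{x_{0,n},\dots,x_{n,n}\},$$ and $B_n(f,x_{k,n})=f(x_{k,n})$. For $x\in(-1,1)$ let $$O(f,x)=\frac{f(x)-f(1)}{2(x-1)}-\frac{f(x)-f(-1)}{2(x+1)},\qquad E(f,x)=\frac{f(1)-f(x)}{2(x-1)}+\frac{f(-1)-f(x)}{2(x+1)}.$$ A sequence $(n_j)$ is a strictly increasing sequence of natural numbers; it is odd (even) if all $n_j$ are odd (even). A point $x\in[-1,1]$ is regular for $(n_j)$ if there is a $j_0$ such that $x\notin\{x_{0,n_j},\dots,x_{n_j,n_j}\}$ for all $j\ge j_0$. Limits are taken in $\overline{\mathbb R}=\mathbb R\cup\{-\infty,+\infty\}$. For rational $x\in[-1,1]$ let $\mathcal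 O(x)$ (respectively $\mathcal E(x)$) be the set of all $y\in\overline{\mathbb R}$ such that $D_{n_j}(x)/n_j\to y$ for some odd (respectively even) sequence $(n_j)$ for which $x$ is regular. **Theorem.** Let $f:[-1,1]\to\mathbb R$ be differentiable at every point of $[-1,1]$ (one-sidedly at $\pm1$) with $f'$ absolutely continuous on $[-1,1]$, and let $x\in[-1,1]$. 1. Let $x$ be irrational. If $(n_j)$ is an odd sequence and $n_j\,(B_{n_j}(f,x)-f(x))\to L\in\overline{\mathbb R}$, then $L\in\mathcal O(f,x):=\left[-\tfrac{2|O(f,x)|}{\pi},\tfrac{2|O(f,x)|}{\pi}\right]$. Conversely, for every $L\in\mathcal O(f,x)$ there is an odd sequence $(n_j)$ for which $x$ is regular and $n_j\,(B_{n_j}(f,x)-f(x))\to L$. 2. Let $x$ be rational. Then $\mathcal O(x)$ is a finite subset of $\mathbb R\setminus\{0\}$. If $(n_j)$ is an odd sequence for which $x$ is regular and $n_j\,(B_{n_j}(f,x)-f(x))\to L\in\overline{\mathbb R}$, then $L\in\mathcal O(f,x):=\{O(f,x)/y : y\in\mathcal O(x)\}$. Conversely, for every $L\in\mathcal O(f,x)$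 there is an odd sequence $(n_j)$ for which $x$ is regular and $n_j\,(B_{n_j}(f,x)-f(x))\to L$. 3. Both parts hold for even sequences, with $E(f,x)$, $\mathcal E(x)$ and $\mathcal E(f,x)$ in place of $O(f,x)$, $\mathcal O(x)$ and $\mathcal O(f,x)$. (For $x=\pm1$ no sequence makes $x$ regular, so $\mathcal O(x)=\mathcal E(x)=\emptyset$, the sets $\mathcal O(f,x)$ and $\mathcal E(f,x)$ are empty, and part 2 holds trivially.) -/

import Mathlib

open Set Filter Topology

namespace Berrut

/-- The class `AC¹` on `[-1, 1]`: `f` has a derivative at every point of `[-1, 1]` (one-sided at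
the end points), and this derivative is an absolutely continuous function on `[-1, 1]`. -/
def AC1 (f : ℝ → ℝ) : Prop :=
  DifferentiableOn ℝ f (Icc (-1) 1) ∧
    AbsolutelyContinuousOnInterval (derivWithin f (Icc (-1) 1)) (-1) 1

/-- The equally spaced nodes `x_{k,n} = 2 k / n - 1`. -/
noncomputable def node (n k : ℕ) : ℝ := 2 * (k : ℝ) / (n : ℝ) - 1

/-- `x` is one of the nodes `x_{0,n}, …, x_{n,n}`. -/
def IsNode (n : ℕ) (x : ℝ) : Prop := ∃ k : ℕ, k ≤ n ∧ x = node n k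

/-- The numerator `N_n(f, x)`. -/
noncomputable def numer (n : ℕ) (f : ℝ → ℝ) (x : ℝ) : ℝ :=
  ∑ k ∈ Finset.range (n + 1), (-1 : ℝ) ^ k * (f (node n k) / (x - node n k))

/-- The denominator `D_n(x)`. -/
noncomputable def denom (n : ℕ) (x : ℝ) : ℝ :=
  ∑ k ∈ Finset.range (n + 1), (-1 : ℝ) ^ k * (1 / (x - node n k))

open Classical in
/-- Berrut's interpolant `B_n(f, x)`. -/
noncomputable def interp (n : ℕ) (f : ℝ → ℝ) (x : ℝ) : ℝ :=
  if IsNode n x then f x else numer n f x / denom n x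

/-- The function `O(f, x)`. -/
noncomputable def oddBias (f : ℝ → ℝ) (x : ℝ) : ℝ :=
  (f x - f 1) / (2 * (x - 1)) - (f x - f (-1)) / (2 * (x + 1))

/-- The function `E(f, x)`. -/
noncomputable def evenBias (f : ℝ → ℝ) (x : ℝ) : ℝ :=
  (f 1 - f x) / (2 * (x - 1)) + (f (-1) - f x) / (2 * (x + 1))

/-- An odd sequence `n_j`. -/
def OddSeq (n : ℕ → ℕ) : Prop := StrictMono n ∧ ∀ j, Odd (n j)

/-- An even sequence `n_j`. -/
def EvenSeq (n : ℕ → ℕ) : Prop := StrictMono n ∧ ∀ j, Even (n j)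

/-- `x` is regular for the sequence `n_j`: it is not a node once `j` is large. -/
def Regular (n : ℕ → ℕ) (x : ℝ) : Prop := ∃ j₀ : ℕ, ∀ j, j₀ ≤ j → ¬ IsNode (n j) x

/-- `n_j (B_{n_j}(f, x) - f(x))` converges to `L` in the extended real line. -/
def ErrorTendsto (f : ℝ → ℝ) (x : ℝ) (n : ℕ → ℕ) (L : EReal) : Prop :=
  Tendsto (fun j => (((n j : ℝ) * (interp (n j) f x - f x) : ℝ) : EReal)) atTop (𝓝 L)

/-- `D_{n_j}(x) / n_j` converges to `L` in the extended real line. -/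
def DenomTendsto (x : ℝ) (n : ℕ → ℕ) (L : EReal) : Prop :=
  Tendsto (fun j => ((1 / (n j : ℝ) * denom (n j) x : ℝ) : EReal)) atTop (𝓝 L)

/-- The set `𝒪(x)`: the limits, in the extended real line, of `D_{n_j}(x) / n_j` over the odd
sequences for which `x` is regular. -/
def oddDenomLimits (x : ℝ) : Set EReal :=
  {y | ∃ n : ℕ → ℕ, OddSeq n ∧ Regular n x ∧ DenomTendsto x n y}

/-- The set `ℰ(x)`: the limits, in the extended real line, of `D_{n_j}(x) / n_j` over the even
sequences for which `x` is regular. -/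
def evenDenomLimits (x : ℝ) : Set EReal :=
  {y | ∃ n : ℕ → ℕ, EvenSeq n ∧ Regular n x ∧ DenomTendsto x n y}

/-- The interval `[-2 |c| / π, 2 |c| / π]`, as a set of extended reals. -/
noncomputable def irrationalLimits (c : ℝ) : Set EReal :=
  Icc ((-(2 * |c| / Real.pi) : ℝ) : EReal) ((2 * |c| / Real.pi : ℝ) : EReal)

/-- The set `{c / y : y ∈ Y}`. -/
noncomputable def rationalLimits (c : ℝ) (Y : Set EReal) : Set EReal :=
  (fun y : EReal => (c : EReal) / y) '' Y

/-- `Y` is a finite subset of `ℝ \ {0}`. -/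
def FiniteNonzeroReals (Y : Set EReal) : Prop :=
  Y.Finite ∧ ∀ y ∈ Y, ∃ r : ℝ, r ≠ 0 ∧ y = (r : EReal)

end Berrut

/-!
Write `g(t) = (f t - f x) / (t - x)`, `S n = ∑ (-1)^k g(x_{k,n})` and `s n = sin (π n (1 + x) / 2)`.
Away from the nodes, `n (B_n(f, x) - f x) = -S n / (D_n(x) / n)`, and the two factors have simple
asymptotics.

* Since `f'` is absolutely continuous, so is `g`, being the mean of `f'` over the segment from `x`
  to `t` (`absolutelyContinuousOnInterval_segmentMean`). For an absolutely continuous `g`, pairing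
  consecutive terms of `S n` leaves half of the two boundary terms and an alternating sum of
  increments, which tends to zero by approximating `g'` in `L¹` by continuous functions
  (`tendsto_sum_neg_one_pow_mul_sub`). Hence `-S n` converges to `oddBias f x` along odd `n` and
  to `evenBias f x` along even `n`.
* By the partial fraction expansion of `π / sin (π t)` and the error bound for alternating series,
  `s n * (D_n(x) / n) = π / 2 + O(1 / n)` as long as `x` is not a node
  (`abs_sin_mul_denom_sub_le`).

So, with `c` the bias of the given parity, `n (B_n(f, x) - f x) = (2 c / π) s n + o(1)`. If `x` is
irrational, the multiples of `π (1 + x)` are dense modulo `2 π`, and `s n` has every point of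
`[-1, 1]` as a limit along each parity class. If `x` is rational, `s n` takes finitely many values,
nonzero in the regular case; the limits of `D_n(x) / n` are then among the numbers `π / (2 σ)`,
with `σ ≠ 0` such a value. Every regular sequence has a subsequence along which `D_n(x) / n` tends
to one of these numbers `y`, and there the error tends to `c / y`.
-/

namespace Berrut

/-! ### Alternating sums over the nodes -/

/-- An alternating sum is controlled by one term and the increments: consecutive terms cancel in
pairs, and at most one term is left over. -/
theorem abs_sum_neg_one_pow_mul_le {d : ℕ → ℝ} {M w : ℝ} (n : ℕ) (hM : 0 ≤ M) (hw : 0 ≤ w)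
    (hd : ∀ k < n, |d k| ≤ M) (hdiff : ∀ k, k + 1 < n → |d (k + 1) - d k| ≤ w) :
    |∑ k ∈ Finset.range n, (-1 : ℝ) ^ k * d k| ≤ M + n * w := by
  induction n using Nat.twoStepInduction with
  | zero => simpa using hM
  | one =>
    have := hd 0 one_pos
    simp only [Finset.range_one, Finset.sum_singleton, pow_zero, one_mul, Nat.cast_one]
    linarith
  | more n ih _ =>
    rw [Finset.sum_range_succ, Finset.sum_range_succ]
    have h1 := ih (fun k hk => hd k (by omega)) (fun k hk => hdiff k (by omega))
    have h2 := hdiff n (by omega)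
    have h3 : (-1 : ℝ) ^ n * d n + (-1 : ℝ) ^ (n + 1) * d (n + 1)
        = -((-1 : ℝ) ^ n * (d (n + 1) - d n)) := by ring
    have h4 : |(-1 : ℝ) ^ n * d n + (-1 : ℝ) ^ (n + 1) * d (n + 1)| ≤ w := by
      rw [h3, abs_neg, abs_mul, abs_pow, abs_neg, abs_one, one_pow, one_mul]
      exact h2
    rw [add_assoc]
    refine (abs_add_le _ _).trans ?_
    push_cast
    linarith

/-- Summation by parts for an alternating sum: half of each boundary term, and half of the
alternating sum of the increments. -/
theorem sum_neg_one_pow_mul_eq (a : ℕ → ℝ) (n : ℕ) :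
    ∑ k ∈ Finset.range (n + 1), (-1 : ℝ) ^ k * a k =
      (a 0 + (-1) ^ n * a n) / 2 -
        (∑ k ∈ Finset.range n, (-1 : ℝ) ^ k * (a (k + 1) - a k)) / 2 := by
  induction n with
  | zero => simp
  | succ n ih =>
    rw [Finset.sum_range_succ, ih, Finset.sum_range_succ _ n]
    ring

theorem node_zero (n : ℕ) : node n 0 = -1 := by simp [node]

theorem node_self {n : ℕ} (hn : n ≠ 0) : node n n = 1 := by
  have : (n : ℝ) ≠ 0 := Nat.cast_ne_zero.2 hn
  unfold node
  field_simp
  norm_num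

theorem node_succ (n k : ℕ) : node n (k + 1) = node n k + 2 / n := by
  unfold node
  push_cast
  ring

theorem node_mem_Icc {n k : ℕ} (hn : n ≠ 0) (hk : k ≤ n) : node n k ∈ Icc (-1 : ℝ) 1 := by
  have h0 : (0 : ℝ) < n := Nat.cast_pos.2 (Nat.pos_of_ne_zero hn)
  have h1 : (k : ℝ) ≤ n := Nat.cast_le.2 hk
  have h2 : 2 * (k : ℝ) / n ≤ 2 := by rw [div_le_iff₀ h0]; linarith
  have h3 : 0 ≤ 2 * (k : ℝ) / n := by positivity
  unfold node
  constructor <;> linarith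

/-- A continuous function has nearly equal integrals over neighbouring cells, so its alternating
sum of cell integrals tends to zero. -/
theorem tendsto_sum_neg_one_pow_mul_integral {h : ℝ → ℝ} (hc : Continuous h)
    (hs : HasCompactSupport h) :
    Tendsto (fun n : ℕ => ∑ k ∈ Finset.range n,
      (-1 : ℝ) ^ k * ∫ t in (node n k)..(node n (k + 1)), h t) atTop (𝓝 0) := by
  obtain ⟨C, hC⟩ := hc.bounded_above_of_compact_support hs
  have hC0 : 0 ≤ C := (norm_nonneg _).trans (hC 0)
  have huc := hc.uniformContinuous_of_tendsto_cocompact hs.is_zero_at_infty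
  rw [Metric.tendsto_atTop]
  intro ε hε
  obtain ⟨δ, hδ, hh⟩ := Metric.uniformContinuous_iff.1 huc (ε / 4) (by positivity)
  have h1 : Tendsto (fun n : ℕ => (2 : ℝ) / n) atTop (𝓝 0) :=
    tendsto_const_div_atTop_nhds_zero_nat 2
  have h2 : Tendsto (fun n : ℕ => C * ((2 : ℝ) / n)) atTop (𝓝 0) := by
    simpa using h1.const_mul C
  obtain ⟨N, hN⟩ := eventually_atTop.1 ((h1.eventually_lt_const hδ).and
    ((h2.eventually_lt_const (show (0 : ℝ) < ε / 2 by positivity)).and (eventually_gt_atTop 0)))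
  refine ⟨N, fun n hn => ?_⟩
  obtain ⟨hn1, hn2, hn0⟩ := hN n hn
  have hnpos : (0 : ℝ) < n := Nat.cast_pos.2 hn0
  have hstep : (0 : ℝ) < 2 / n := by positivity
  rw [Real.dist_eq, sub_zero]
  have key := abs_sum_neg_one_pow_mul_le
    (d := fun k => ∫ t in (node n k)..(node n (k + 1)), h t)
    (M := C * (2 / n)) (w := ε / 4 * (2 / n)) n (by positivity) (by positivity) ?_ ?_
  · refine key.trans_lt ?_
    have : (n : ℝ) * (ε / 4 * (2 / n)) = ε / 2 := by field_simp; norm_num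
    linarith
  · intro k _
    have := intervalIntegral.norm_integral_le_of_norm_le_const (a := node n k)
      (b := node n (k + 1)) (f := h) (C := C) (fun x _ => hC x)
    rwa [node_succ, add_sub_cancel_left, abs_of_pos hstep, ← node_succ] at this
  · intro k _
    have e : ∫ t in (node n (k + 1))..(node n (k + 1 + 1)), h t
        = ∫ t in (node n k)..(node n (k + 1)), h (t + 2 / n) := by
      rw [intervalIntegral.integral_comp_add_right, ← node_succ, ← node_succ]
    have hc' : Continuous fun t => h (t + 2 / n) := by fun_prop
    rw [e, ← intervalIntegral.integral_sub (hc'.intervalIntegrable _ _)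
      (hc.intervalIntegrable _ _)]
    have := intervalIntegral.norm_integral_le_of_norm_le_const (a := node n k)
      (b := node n (k + 1)) (f := fun t => h (t + 2 / n) - h t) (C := ε / 4) (fun t _ => by
        rw [← dist_eq_norm]
        refine (hh ?_).le
        rw [Real.dist_eq, add_sub_cancel_left, abs_of_pos hstep]
        exact hn1)
    rwa [node_succ, add_sub_cancel_left, abs_of_pos hstep, ← node_succ] at this

/-- The increments of `g` are the cell integrals of `g'`, and `g'` is approximated in `L¹` by a
continuous function; the error is at most the `L¹` distance, uniformly in `n`. -/
theorem tendsto_sum_neg_one_pow_mul_sub {g : ℝ → ℝ}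
    (hg : AbsolutelyContinuousOnInterval g (-1) 1) :
    Tendsto (fun n : ℕ => ∑ k ∈ Finset.range n,
      (-1 : ℝ) ^ k * (g (node n (k + 1)) - g (node n k))) atTop (𝓝 0) := by
  have hint : IntervalIntegrable (deriv g) MeasureTheory.volume (-1) 1 :=
    hg.intervalIntegrable_deriv
  rw [Metric.tendsto_atTop]
  intro ε hε
  obtain ⟨h, hs, hle, hc, -⟩ := MeasureTheory.Integrable.exists_hasCompactSupport_integral_sub_le
    ((intervalIntegrable_iff_integrableOn_Ioc_of_le (by norm_num)).1 hint)
    (show (0 : ℝ) < ε / 2 by positivity)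
  obtain ⟨N, hN⟩ := Metric.tendsto_atTop.1 (tendsto_sum_neg_one_pow_mul_integral hc hs) (ε / 2)
    (by positivity)
  refine ⟨max N 1, fun n hn => ?_⟩
  have hn0 : n ≠ 0 := by have := (le_max_right N 1).trans hn; omega
  have hN' := hN n ((le_max_left _ _).trans hn)
  rw [Real.dist_eq, sub_zero] at hN' ⊢
  have hsub : ∀ k < n, uIcc (node n k) (node n (k + 1)) ⊆ uIcc (-1 : ℝ) 1 := by
    intro k hk
    rw [uIcc_of_le (show (-1 : ℝ) ≤ 1 by norm_num)]
    exact uIcc_subset_Icc (node_mem_Icc hn0 hk.le) (node_mem_Icc hn0 hk)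
  have hle' : ∀ k, node n k ≤ node n (k + 1) := fun k => by
    rw [node_succ]; have : (0 : ℝ) ≤ 2 / n := by positivity
    linarith
  have hi : IntervalIntegrable (fun t => deriv g t - h t) MeasureTheory.volume (-1) 1 :=
    hint.sub (hc.intervalIntegrable _ _)
  have e : ∑ k ∈ Finset.range n, (-1 : ℝ) ^ k * (g (node n (k + 1)) - g (node n k))
      = ∑ k ∈ Finset.range n, (-1 : ℝ) ^ k *
          (∫ t in (node n k)..(node n (k + 1)), (deriv g t - h t))
        + ∑ k ∈ Finset.range n, (-1 : ℝ) ^ k * ∫ t in (node n k)..(node n (k + 1)), h t := by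
    rw [← Finset.sum_add_distrib]
    refine Finset.sum_congr rfl fun k hk => ?_
    have hk' := Finset.mem_range.1 hk
    rw [← (hg.mono (hsub k hk')).integral_deriv_eq_sub, ← mul_add,
      intervalIntegral.integral_sub (hint.mono_set (hsub k hk')) (hc.intervalIntegrable _ _),
      sub_add_cancel]
  have b : |∑ k ∈ Finset.range n, (-1 : ℝ) ^ k *
      (∫ t in (node n k)..(node n (k + 1)), (deriv g t - h t))| ≤ ε / 2 := by
    calc _ ≤ ∑ k ∈ Finset.range n, |(-1 : ℝ) ^ k *
          (∫ t in (node n k)..(node n (k + 1)), (deriv g t - h t))| :=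
        Finset.abs_sum_le_sum_abs _ _
      _ ≤ ∑ k ∈ Finset.range n, ∫ t in (node n k)..(node n (k + 1)), ‖deriv g t - h t‖ := by
        refine Finset.sum_le_sum fun k _ => ?_
        rw [abs_mul, abs_pow, abs_neg, abs_one, one_pow, one_mul]
        exact intervalIntegral.norm_integral_le_integral_norm (E := ℝ) (hle' k)
      _ = ∫ t in (-1 : ℝ)..1, ‖deriv g t - h t‖ := by
        rw [intervalIntegral.sum_integral_adjacent_intervals
          (fun k hk => hi.norm.mono_set (hsub k hk)), node_zero, node_self hn0]
      _ ≤ ε / 2 := by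
        rw [intervalIntegral.integral_of_le (show (-1 : ℝ) ≤ 1 by norm_num)]
        exact hle
  rw [e]
  refine (abs_add_le _ _).trans_lt ?_
  linarith

/-! ### Divided differences -/

/-- The mean of `F` over the segment from `x` to `t`. For `F = f'` this is the divided difference
`(f t - f x) / (t - x)`, continued to `t = x` by `f' x`. -/
noncomputable def segmentMean (F : ℝ → ℝ) (x t : ℝ) : ℝ :=
  ∫ s in (0 : ℝ)..1, F (x + s * (t - x))

theorem segment_mem_Icc {a b x t s : ℝ} (hx : x ∈ Icc a b) (ht : t ∈ Icc a b)
    (hs : s ∈ Icc (0 : ℝ) 1) : x + s * (t - x) ∈ Icc a b := by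
  have := (convex_Icc a b).add_smul_sub_mem hx ht hs
  simpa using this

theorem intervalIntegrable_segment {F : ℝ → ℝ} {a b x t : ℝ} (hF : ContinuousOn F (Icc a b))
    (hx : x ∈ Icc a b) (ht : t ∈ Icc a b) :
    IntervalIntegrable (fun s => F (x + s * (t - x))) MeasureTheory.volume 0 1 := by
  refine ContinuousOn.intervalIntegrable_of_Icc zero_le_one ?_
  exact hF.comp (by fun_prop) fun s hs => segment_mem_Icc hx ht hs

/-- Each dilation `t ↦ x + s (t - x)` with `0 ≤ s ≤ 1` maps disjoint intervals in `[a, b]` to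
disjoint intervals in `[a, b]` of no larger total length, so the modulus of absolute continuity of
`F` serves for all `s` at once and survives averaging over `s`. -/
theorem absolutelyContinuousOnInterval_segmentMean {F : ℝ → ℝ} {a b x : ℝ} (hab : a ≤ b)
    (hF : AbsolutelyContinuousOnInterval F a b) (hx : x ∈ Icc a b) :
    AbsolutelyContinuousOnInterval (segmentMean F x) a b := by
  have hcont : ContinuousOn F (Icc a b) := by simpa [uIcc_of_le hab] using hF.continuousOn
  rw [absolutelyContinuousOnInterval_iff] at hF ⊢
  intro ε hε
  obtain ⟨δ, hδ, H⟩ := hF (ε / 2) (by positivity)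
  refine ⟨δ, hδ, fun E hE hlen => ?_⟩
  have hE1 : ∀ i ∈ Finset.range E.1, (E.2 i).1 ∈ Icc a b ∧ (E.2 i).2 ∈ Icc a b := by
    simpa [uIcc_of_le hab] using hE.1
  have hi1 : ∀ i ∈ Finset.range E.1, IntervalIntegrable
      (fun s => F (x + s * ((E.2 i).1 - x))) MeasureTheory.volume 0 1 := fun i hi =>
    intervalIntegrable_segment hcont hx (hE1 i hi).1
  have hi2 : ∀ i ∈ Finset.range E.1, IntervalIntegrable
      (fun s => F (x + s * ((E.2 i).2 - x))) MeasureTheory.volume 0 1 := fun i hi =>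
    intervalIntegrable_segment hcont hx (hE1 i hi).2
  have hi : ∀ i ∈ Finset.range E.1, IntervalIntegrable
      (fun s => dist (F (x + s * ((E.2 i).1 - x))) (F (x + s * ((E.2 i).2 - x))))
      MeasureTheory.volume 0 1 := fun i hi => by
    simpa only [dist_eq_norm] using ((hi1 i hi).sub (hi2 i hi)).norm
  calc ∑ i ∈ Finset.range E.1,
        dist (segmentMean F x (E.2 i).1) (segmentMean F x (E.2 i).2)
      ≤ ∑ i ∈ Finset.range E.1, ∫ s in (0 : ℝ)..1,
          dist (F (x + s * ((E.2 i).1 - x))) (F (x + s * ((E.2 i).2 - x))) := by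
        refine Finset.sum_le_sum fun i hi => ?_
        unfold segmentMean
        rw [dist_eq_norm, ← intervalIntegral.integral_sub (hi1 i hi) (hi2 i hi)]
        simp only [dist_eq_norm]
        exact intervalIntegral.norm_integral_le_integral_norm zero_le_one
    _ = ∫ s in (0 : ℝ)..1, ∑ i ∈ Finset.range E.1,
          dist (F (x + s * ((E.2 i).1 - x))) (F (x + s * ((E.2 i).2 - x))) :=
        (intervalIntegral.integral_finsetSum hi).symm
    _ ≤ ∫ s in (0 : ℝ)..1, ε / 2 := by
        refine intervalIntegral.integral_mono_on zero_le_one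
          (by simpa only [Finset.sum_fn] using IntervalIntegrable.sum _ hi)
          intervalIntegrable_const fun s hs => ?_
        refine (H (E.1, fun i => (x + s * ((E.2 i).1 - x), x + s * ((E.2 i).2 - x)))
          ⟨fun i hi => ?_, ?_⟩ ?_).le
        · rw [uIcc_of_le hab]
          exact ⟨segment_mem_Icc hx (hE1 i hi).1 hs, segment_mem_Icc hx (hE1 i hi).2 hs⟩
        · -- the intervals stay disjoint under the dilation `t ↦ x + s (t - x)`
          rcases hs.1.eq_or_lt with h0 | h0
          · subst h0
            intro i _ j _ _
            simp [Function.onFun]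
          · intro i hi j hj hij
            have := hE.2 hi hj hij
            simp only [Function.onFun] at this ⊢
            rw [Set.disjoint_left] at this ⊢
            have tr : ∀ u v y : ℝ, y ∈ uIoc (x + s * (u - x)) (x + s * (v - x)) →
                x + (y - x) / s ∈ uIoc u v := by
              intro u v y hy
              have hm : ∀ p q : ℝ, x + s * (p - x) < q ↔ p < x + (q - x) / s := by
                intro p q
                rw [← sub_lt_iff_lt_add', lt_div_iff₀ h0, ← lt_sub_iff_add_lt', mul_comm]
              have hm' : ∀ p q : ℝ, q ≤ x + s * (p - x) ↔ x + (q - x) / s ≤ p := by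
                intro p q
                rw [← not_lt, ← not_lt, hm]
              simpa [mem_uIoc, hm, hm'] using hy
            intro y hy hy'
            exact this (tr _ _ y hy) (tr _ _ y hy')
        · refine lt_of_le_of_lt (Finset.sum_le_sum fun i _ => ?_) hlen
          simp only [Real.dist_eq]
          rw [show x + s * ((E.2 i).1 - x) - (x + s * ((E.2 i).2 - x))
            = s * ((E.2 i).1 - (E.2 i).2) by ring, abs_mul, abs_of_nonneg hs.1]
          exact mul_le_of_le_one_left (abs_nonneg _) hs.2
    _ = ε / 2 := by simp
    _ < ε := by linarith

theorem sub_eq_segmentMean_mul {f : ℝ → ℝ} {a b x t : ℝ} (hf : DifferentiableOn ℝ f (Icc a b))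
    (hf' : ContinuousOn (derivWithin f (Icc a b)) (Icc a b)) (hx : x ∈ Icc a b)
    (ht : t ∈ Icc a b) :
    f t - f x = segmentMean (derivWithin f (Icc a b)) x t * (t - x) := by
  rcases eq_or_ne t x with rfl | hne
  · simp
  have hmaps : MapsTo (fun s : ℝ => x + s * (t - x)) (Icc 0 1) (Icc a b) :=
    fun s hs => segment_mem_Icc hx ht hs
  have := intervalIntegral.integral_eq_sub_of_hasDerivAt_of_le (a := 0) (b := 1)
    (f := fun s => f (x + s * (t - x)))
    (f' := fun s => derivWithin f (Icc a b) (x + s * (t - x)) * (t - x)) zero_le_one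
    (hf.continuousOn.comp (by fun_prop) hmaps) ?_
    ((intervalIntegrable_segment hf' hx ht).mul_const _)
  · rw [intervalIntegral.integral_mul_const] at this
    simpa [segmentMean] using this.symm
  · intro s hs
    have h1 : HasDerivWithinAt (fun s : ℝ => x + s * (t - x)) (t - x) (Icc 0 1) s := by
      simpa using (((hasDerivAt_id s).mul_const (t - x)).const_add x).hasDerivWithinAt
    have h2 := (hf _ (hmaps (Ioo_subset_Icc_self hs))).hasDerivWithinAt
    exact (h2.comp s h1 hmaps).hasDerivAt (Icc_mem_nhds hs.1 hs.2)

/-! ### The partial fraction expansion of `π / sin` -/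

theorem abs_alternating_sum_sub_le {a : ℕ → ℝ} {l : ℝ} (ha : Antitone a)
    (hl : Tendsto (fun n => ∑ i ∈ Finset.range n, (-1 : ℝ) ^ i * a i) atTop (𝓝 l)) (n : ℕ) :
    |∑ i ∈ Finset.range n, (-1 : ℝ) ^ i * a i - l| ≤ a n := by
  rw [abs_le]
  rcases Nat.even_or_odd' n with ⟨k, rfl | rfl⟩
  · have h1 := ha.alternating_series_le_tendsto hl k
    have h2 := ha.tendsto_le_alternating_series hl k
    rw [Finset.sum_range_succ, pow_mul, neg_one_sq, one_pow, one_mul] at h2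
    have h3 : 0 ≤ a (2 * k) := by linarith
    constructor <;> linarith
  · have h1 := ha.alternating_series_le_tendsto hl (k + 1)
    have h2 := ha.tendsto_le_alternating_series hl k
    rw [show 2 * (k + 1) = 2 * k + 1 + 1 by ring, Finset.sum_range_succ, pow_succ, pow_mul,
      neg_one_sq, one_pow, one_mul, neg_one_mul] at h1
    constructor <;> linarith

theorem exists_alternating_reciprocal_limit {θ : ℝ} (hθ : 0 < θ) : ∃ l : ℝ,
    Tendsto (fun n : ℕ => ∑ i ∈ Finset.range n, (-1 : ℝ) ^ i * (1 / (θ + i))) atTop (𝓝 l) ∧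
    ∀ n : ℕ, |∑ i ∈ Finset.range n, (-1 : ℝ) ^ i * (1 / (θ + i)) - l| ≤ 1 / (θ + n) := by
  have ha : Antitone fun i : ℕ => 1 / (θ + i) := by
    intro i j hij
    have : (i : ℝ) ≤ j := Nat.cast_le.2 hij
    dsimp only
    gcongr
  have h0 : Tendsto (fun i : ℕ => 1 / (θ + i)) atTop (𝓝 0) :=
    tendsto_const_nhds.div_atTop (tendsto_atTop_add_const_left _ _ tendsto_natCast_atTop_atTop)
  obtain ⟨l, hl⟩ := ha.tendsto_alternating_series_of_tendsto_zero h0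
  exact ⟨l, hl, abs_alternating_sum_sub_le ha hl⟩

/-- The symmetric partial sums of the cotangent series at `z / 2` contain the even-indexed terms of
the series at `z` twice, so the difference is the alternating series `∑ (-1)^k / (z + k)`, here
split into its two one-sided halves. The last term is the unpaired one with index `2 N`. No
hypothesis on `z` is needed, since `1 / 0 = 0` on both sides. -/
theorem cot_partial_sum_identity (z : ℂ) (N : ℕ) :
    (1 / (z / 2) + ∑ j ∈ Finset.range N, cotTerm (z / 2) j)
      - (1 / z + ∑ j ∈ Finset.range (2 * N), cotTerm z j) =
    ∑ i ∈ Finset.range (2 * N), (-1 : ℂ) ^ i * (1 / (z + i))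
      + ∑ i ∈ Finset.range (2 * N), (-1 : ℂ) ^ i * (1 / (1 - z + i)) + 1 / (z + (2 * N : ℕ)) := by
  have half : ∀ w : ℂ, 1 / (w / 2) = 2 * (1 / w) := fun w => by
    rw [one_div_div, mul_one_div]
  induction N with
  | zero => simp [half]; ring
  | succ N ih =>
    rw [show 2 * (N + 1) = 2 * N + 1 + 1 by ring]
    simp only [Finset.sum_range_succ]
    have e1 : cotTerm (z / 2) N
        = 2 * (1 / (z - (2 * N + 2))) + 2 * (1 / (z + (2 * N + 2))) := by
      rw [← half, ← half, cotTerm]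
      congr 2 <;> ring
    have e2 : (1 : ℂ) / (1 - z + (2 * N : ℕ)) = -(1 / (z - (2 * N + 1))) := by
      rw [← one_div_neg_eq_neg_one_div]; congr 1; push_cast; ring
    have e3 : (1 : ℂ) / (1 - z + (2 * N + 1 : ℕ)) = -(1 / (z - (2 * N + 2))) := by
      rw [← one_div_neg_eq_neg_one_div]; congr 1; push_cast; ring
    have p1 : (-1 : ℂ) ^ (2 * N) = 1 := by rw [pow_mul]; simp
    have p2 : (-1 : ℂ) ^ (2 * N + 1) = -1 := by rw [pow_succ, p1]; simp
    rw [e1, e2, e3, p1, p2, cotTerm, cotTerm]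
    push_cast at ih ⊢
    rw [show z - (2 * (N : ℂ) + 1 + 1) = z - (2 * N + 2) by ring,
      show z + (2 * (N : ℂ) + 1 + 1) = z + (2 * N + 2) by ring]
    linear_combination ih

theorem cot_half_sub_cot {w : ℂ} (h : Complex.sin w ≠ 0) :
    Complex.cot (w / 2) - Complex.cot w = 1 / Complex.sin w := by
  have hw : w = 2 * (w / 2) := by ring
  have hs : Complex.sin w = 2 * Complex.sin (w / 2) * Complex.cos (w / 2) := by
    conv_lhs => rw [hw]
    exact Complex.sin_two_mul _
  have hc : Complex.cos w = 2 * Complex.cos (w / 2) ^ 2 - 1 := by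
    conv_lhs => rw [hw]
    exact Complex.cos_two_mul _
  have h1 : Complex.sin (w / 2) ≠ 0 := fun h0 => h (by rw [hs, h0]; ring)
  have h2 : Complex.cos (w / 2) ≠ 0 := fun h0 => h (by rw [hs, h0]; ring)
  rw [Complex.cot_eq_cos_div_sin, Complex.cot_eq_cos_div_sin, hs, hc]
  field_simp
  ring

theorem mem_integerComplement_of_mem_Ioo {θ : ℝ} (h : θ ∈ Ioo (0 : ℝ) 1) :
    (θ : ℂ) ∈ Complex.integerComplement := by
  rintro ⟨k, hk⟩
  have hk' : (k : ℝ) = θ := by exact_mod_cast hk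
  rw [← hk'] at h
  have h1 : 0 < k := by exact_mod_cast h.1
  have h2 : k < 1 := by exact_mod_cast h.2
  omega

/-- The expansion of `π / sin (π θ)` follows from that of the cotangent through
`cot (w / 2) - cot w = 1 / sin w`. -/
theorem tendsto_alternating_reciprocal_sum {θ : ℝ} (hθ : θ ∈ Ioo (0 : ℝ) 1) :
    Tendsto (fun N : ℕ => ∑ i ∈ Finset.range (2 * N), (-1 : ℝ) ^ i * (1 / (θ + i))
      + ∑ i ∈ Finset.range (2 * N), (-1 : ℝ) ^ i * (1 / (1 - θ + i))) atTop
      (𝓝 (Real.pi / Real.sin (Real.pi * θ))) := by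
  have hz := mem_integerComplement_of_mem_Ioo hθ
  have hz2 : ((θ : ℂ) / 2) ∈ Complex.integerComplement := by
    have := mem_integerComplement_of_mem_Ioo (θ := θ / 2) ⟨by linarith [hθ.1], by linarith [hθ.2]⟩
    simpa using this
  have htwo : Tendsto (fun N : ℕ => 2 * N) atTop atTop :=
    tendsto_id.const_mul_atTop' two_pos
  have t1 := (tendsto_logDeriv_euler_cot_sub hz2).const_add (1 / ((θ : ℂ) / 2))
  have t2 := ((tendsto_logDeriv_euler_cot_sub hz).const_add (1 / (θ : ℂ))).comp htwo
  have t3 : Tendsto (fun N : ℕ => (((1 / (θ + (2 * N : ℕ)) : ℝ)) : ℂ)) atTop (𝓝 ((0 : ℝ) : ℂ)) := by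
    refine (Complex.continuous_ofReal.tendsto _).comp ?_
    exact tendsto_const_nhds.div_atTop (tendsto_atTop_add_const_left _ _
      (tendsto_natCast_atTop_atTop.comp htwo))
  have t := (t1.sub t2).sub t3
  have hsin := sin_pi_mul_ne_zero hz
  have hlim : 1 / ((θ : ℂ) / 2) + (Real.pi * Complex.cot (Real.pi * (θ / 2)) - 1 / ((θ : ℂ) / 2))
      - (1 / (θ : ℂ) + (Real.pi * Complex.cot (Real.pi * θ) - 1 / (θ : ℂ))) - ((0 : ℝ) : ℂ)
      = ((Real.pi / Real.sin (Real.pi * θ) : ℝ) : ℂ) := by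
    have := cot_half_sub_cot hsin
    push_cast
    rw [show (Real.pi : ℂ) * (θ / 2) = Real.pi * θ / 2 by ring, div_eq_mul_one_div (Real.pi : ℂ),
      ← this]
    ring
  rw [hlim] at t
  rw [← Filter.tendsto_ofReal_iff]
  refine t.congr fun N => ?_
  simp only [Function.comp]
  rw [cot_partial_sum_identity]
  push_cast
  ring

/-! ### Asymptotics of the denominator -/

/-- With `t = m + θ`, the sum over `k ≤ m + p` of `(-1)^k / (t - k)` splits at `k = m` into partial
sums of the two one-sided alternating series at `θ` and `1 - θ`; the bound is the sum of the first
omitted terms. -/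
theorem abs_sin_nat_add_mul_alternating_sum_sub_pi_le {θ : ℝ} (hθ : θ ∈ Ioo (0 : ℝ) 1)
    (m p : ℕ) :
    |Real.sin (Real.pi * (m + θ)) *
        ∑ k ∈ Finset.range (m + 1 + p), (-1 : ℝ) ^ k * (1 / (m + θ - k)) - Real.pi|
      ≤ 1 / (θ + (m + 1 : ℕ)) + 1 / (1 - θ + p) := by
  obtain ⟨l₁, ht₁, hb₁⟩ := exists_alternating_reciprocal_limit hθ.1
  obtain ⟨l₂, ht₂, hb₂⟩ := exists_alternating_reciprocal_limit (sub_pos.2 hθ.2)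
  have htwo : Tendsto (fun N : ℕ => 2 * N) atTop atTop :=
    tendsto_id.const_mul_atTop' two_pos
  have hl : l₁ + l₂ = Real.pi / Real.sin (Real.pi * θ) :=
    tendsto_nhds_unique ((ht₁.comp htwo).add (ht₂.comp htwo))
      (tendsto_alternating_reciprocal_sum hθ)
  have hsin : 0 < Real.sin (Real.pi * θ) := by
    apply Real.sin_pos_of_pos_of_lt_pi
    · exact mul_pos Real.pi_pos hθ.1
    · exact mul_lt_of_lt_one_right Real.pi_pos hθ.2
  have hs : Real.sin (Real.pi * (m + θ)) = (-1) ^ m * Real.sin (Real.pi * θ) := by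
    rw [show Real.pi * (m + θ) = Real.pi * θ + m * Real.pi by ring, Real.sin_add_nat_mul_pi]
  have hsq : ((-1 : ℝ) ^ m) * (-1) ^ m = 1 := by rw [← mul_pow]; simp
  have hsum : ∑ k ∈ Finset.range (m + 1 + p), (-1 : ℝ) ^ k * (1 / (m + θ - k)) =
      (-1) ^ m * (∑ i ∈ Finset.range (m + 1), (-1 : ℝ) ^ i * (1 / (θ + i)) +
        ∑ i ∈ Finset.range p, (-1 : ℝ) ^ i * (1 / (1 - θ + i))) := by
    rw [Finset.sum_range_add, mul_add, Finset.mul_sum, Finset.mul_sum]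
    congr 1
    · rw [← Finset.sum_range_reflect]
      refine Finset.sum_congr rfl fun i hi => ?_
      have hi' : i ≤ m := Nat.lt_succ_iff.1 (Finset.mem_range.1 hi)
      rw [show m + 1 - 1 - i = m - i by omega, Nat.cast_sub hi',
        show (m : ℝ) + θ - (m - i) = θ + i by ring, ← mul_assoc]
      congr 1
      obtain ⟨q, rfl⟩ := Nat.exists_eq_add_of_le hi'
      rw [add_tsub_cancel_left, pow_add, mul_right_comm, ← mul_pow]
      simp
    · refine Finset.sum_congr rfl fun i _ => ?_
      push_cast
      rw [show (m : ℝ) + θ - (m + 1 + i) = -(1 - θ + i) by ring, one_div_neg_eq_neg_one_div]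
      ring
  have e : Real.sin (Real.pi * (m + θ)) *
      ∑ k ∈ Finset.range (m + 1 + p), (-1 : ℝ) ^ k * (1 / (m + θ - k)) - Real.pi =
      Real.sin (Real.pi * θ) * ((∑ i ∈ Finset.range (m + 1), (-1 : ℝ) ^ i * (1 / (θ + i)) - l₁) +
        (∑ i ∈ Finset.range p, (-1 : ℝ) ^ i * (1 / (1 - θ + i)) - l₂)) := by
    have : Real.pi = Real.sin (Real.pi * θ) * (l₁ + l₂) := by rw [hl]; field_simp
    rw [hsum, hs]
    linear_combination (Real.sin (Real.pi * θ) *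
      (∑ i ∈ Finset.range (m + 1), (-1 : ℝ) ^ i * (1 / (θ + i)) +
        ∑ i ∈ Finset.range p, (-1 : ℝ) ^ i * (1 / (1 - θ + i)))) * hsq - this
  rw [e, abs_mul, abs_of_pos hsin]
  refine (mul_le_of_le_one_left (abs_nonneg _) (Real.sin_le_one _)).trans ?_
  exact (abs_add_le _ _).trans (add_le_add (hb₁ _) (hb₂ _))

theorem abs_sin_mul_alternating_sum_sub_pi_le {n : ℕ} {t : ℝ} (h0 : 0 < t) (hn : t < n)
    (hk : ∀ k : ℕ, t ≠ k) :
    |Real.sin (Real.pi * t) * ∑ k ∈ Finset.range (n + 1), (-1 : ℝ) ^ k * (1 / (t - k)) - Real.pi|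
      ≤ 1 / t + 1 / (n - t) := by
  have hfl := Nat.floor_le h0.le
  have hlt := Nat.lt_floor_add_one t
  have hmn : ⌊t⌋₊ < n := by
    have : (⌊t⌋₊ : ℝ) < n := hfl.trans_lt hn
    exact_mod_cast this
  obtain ⟨p, hp⟩ := Nat.exists_eq_add_of_le hmn.le
  have hθ : t - ⌊t⌋₊ ∈ Ioo (0 : ℝ) 1 :=
    ⟨sub_pos.2 (lt_of_le_of_ne hfl (hk _).symm), by linarith⟩
  have key := abs_sin_nat_add_mul_alternating_sum_sub_pi_le hθ ⌊t⌋₊ p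
  have hpn : (n : ℝ) = ⌊t⌋₊ + p := by exact_mod_cast hp
  rw [add_sub_cancel, show ⌊t⌋₊ + 1 + p = n + 1 by omega] at key
  refine key.trans ?_
  have h1 : 0 < n - t := sub_pos.2 hn
  gcongr
  · push_cast; linarith
  · linarith

theorem abs_sin_mul_denom_sub_le {n : ℕ} {x : ℝ} (hx : x ∈ Ioo (-1 : ℝ) 1) (hn : n ≠ 0)
    (hnode : ¬ IsNode n x) :
    |Real.sin (Real.pi * (n * ((1 + x) / 2))) * (1 / (n : ℝ) * denom n x) - Real.pi / 2|
      ≤ (1 / (1 + x) + 1 / (1 - x)) / n := by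
  have hn0 : (0 : ℝ) < n := Nat.cast_pos.2 (Nat.pos_of_ne_zero hn)
  have hx1 : 0 < 1 + x := by linarith [hx.1]
  have hx2 : 0 < 1 - x := by linarith [hx.2]
  set t : ℝ := n * ((1 + x) / 2) with ht
  have ht0 : 0 < t := by positivity
  have htn : (n : ℝ) - t = n * ((1 - x) / 2) := by rw [ht]; ring
  have htn' : 0 < (n : ℝ) - t := by rw [htn]; positivity
  have hxt : x = 2 * t / n - 1 := by rw [ht]; field_simp; ring
  have hk : ∀ k : ℕ, t ≠ k := by
    intro k hk
    refine hnode ⟨k, ?_, ?_⟩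
    · have : (k : ℝ) < n := by rw [← hk]; linarith
      exact_mod_cast this.le
    · rw [hxt, hk, node]
  have key := abs_sin_mul_alternating_sum_sub_pi_le ht0 (sub_pos.1 htn') hk
  have hd : 1 / (n : ℝ) * denom n x =
      (∑ k ∈ Finset.range (n + 1), (-1 : ℝ) ^ k * (1 / (t - k))) / 2 := by
    rw [denom, Finset.mul_sum, Finset.sum_div]
    refine Finset.sum_congr rfl fun k _ => ?_
    have hne : t - k ≠ 0 := sub_ne_zero.2 (hk k)
    have : x - node n k = 2 * (t - k) / n := by
      rw [node, hxt]; ring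
    rw [this]
    field_simp
  have e : Real.sin (Real.pi * t) * (1 / (n : ℝ) * denom n x) - Real.pi / 2 =
      (Real.sin (Real.pi * t) * ∑ k ∈ Finset.range (n + 1), (-1 : ℝ) ^ k * (1 / (t - k))
        - Real.pi) / 2 := by
    rw [hd]; ring
  rw [e, abs_div, abs_two, div_le_iff₀ two_pos]
  refine key.trans (le_of_eq ?_)
  rw [htn, ht]
  field_simp

/-! ### Asymptotics of the error -/

/-- The alternating sum `∑ (-1)^k g(x_{k,n})` of a function over the nodes. -/
noncomputable def altNodeSum (g : ℝ → ℝ) (n : ℕ) : ℝ :=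
  ∑ k ∈ Finset.range (n + 1), (-1 : ℝ) ^ k * g (node n k)

theorem tendsto_altNodeSum_of_odd {g : ℝ → ℝ} (hg : AbsolutelyContinuousOnInterval g (-1) 1) :
    Tendsto (altNodeSum g) (atTop ⊓ 𝓟 {n | Odd n}) (𝓝 ((g (-1) - g 1) / 2)) := by
  have h := ((tendsto_sum_neg_one_pow_mul_sub hg).mono_left
    (inf_le_left (b := 𝓟 {n | Odd n}))).div_const 2 |>.const_sub ((g (-1) - g 1) / 2)
  rw [zero_div, sub_zero] at h
  refine h.congr' ?_
  filter_upwards [mem_inf_of_right (mem_principal_self _)] with n hn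
  have hn' : Odd n := hn
  rw [altNodeSum, sum_neg_one_pow_mul_eq (fun k => g (node n k)), hn'.neg_one_pow, node_zero,
    node_self hn'.pos.ne']
  ring

theorem tendsto_altNodeSum_of_even {g : ℝ → ℝ} (hg : AbsolutelyContinuousOnInterval g (-1) 1) :
    Tendsto (altNodeSum g) (atTop ⊓ 𝓟 {n | Even n}) (𝓝 ((g (-1) + g 1) / 2)) := by
  have h := ((tendsto_sum_neg_one_pow_mul_sub hg).mono_left
    (inf_le_left (b := 𝓟 {n | Even n}))).div_const 2 |>.const_sub ((g (-1) + g 1) / 2)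
  rw [zero_div, sub_zero] at h
  refine h.congr' ?_
  filter_upwards [mem_inf_of_right (mem_principal_self _),
    mem_inf_of_left (eventually_ne_atTop 0)] with n hn hn0
  have hn' : Even n := hn
  rw [altNodeSum, sum_neg_one_pow_mul_eq (fun k => g (node n k)), hn'.neg_one_pow, node_zero,
    node_self hn0]
  ring

/-- `numer n f x - f x * denom n x` is a sum over the nodes whose poles cancel. -/
theorem mul_interp_sub_eq {f g : ℝ → ℝ} {n : ℕ} {x : ℝ} (hn : n ≠ 0) (hx : ¬ IsNode n x)
    (hD : denom n x ≠ 0) (hg : ∀ t ∈ Icc (-1 : ℝ) 1, f t - f x = g t * (t - x)) :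
    (n : ℝ) * (interp n f x - f x) = -altNodeSum g n / (1 / (n : ℝ) * denom n x) := by
  have hn0 : (n : ℝ) ≠ 0 := Nat.cast_ne_zero.2 hn
  have e : numer n f x - f x * denom n x = -altNodeSum g n := by
    rw [numer, denom, altNodeSum, Finset.mul_sum, ← Finset.sum_sub_distrib,
      ← Finset.sum_neg_distrib]
    refine Finset.sum_congr rfl fun k hk => ?_
    have hk' : k ≤ n := Nat.lt_succ_iff.1 (Finset.mem_range.1 hk)
    have hne : x - node n k ≠ 0 := sub_ne_zero.2 fun h => hx ⟨k, hk', h⟩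
    have := hg _ (node_mem_Icc hn hk')
    field_simp
    linear_combination this
  rw [interp, if_neg hx, ← e]
  field_simp

/-- The end points are nodes for every positive `n`. -/
theorem Regular.mem_Ioo {n : ℕ → ℕ} {x : ℝ} (hn : StrictMono n) (hr : Regular n x)
    (hx : x ∈ Icc (-1 : ℝ) 1) : x ∈ Ioo (-1 : ℝ) 1 := by
  obtain ⟨j₀, hj⟩ := hr
  have h := hj (j₀ + 1) (Nat.le_succ _)
  have h0 : n (j₀ + 1) ≠ 0 := by have := hn.le_apply (x := j₀ + 1); omega
  refine ⟨hx.1.lt_of_ne fun e => h ⟨0, Nat.zero_le _, ?_⟩,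
    hx.2.lt_of_ne fun e => h ⟨n (j₀ + 1), le_rfl, ?_⟩⟩
  · rw [node_zero, e]
  · rw [node_self h0, e]

theorem tendsto_sin_mul_denom {n : ℕ → ℕ} {x : ℝ} (hn : StrictMono n) (hr : Regular n x)
    (hx : x ∈ Icc (-1 : ℝ) 1) :
    Tendsto (fun j => Real.sin (Real.pi * (n j * ((1 + x) / 2))) *
      (1 / (n j : ℝ) * denom (n j) x)) atTop (𝓝 (Real.pi / 2)) := by
  have hx' := hr.mem_Ioo hn hx
  rw [tendsto_iff_norm_sub_tendsto_zero]
  have h0 : Tendsto (fun j => (1 / (1 + x) + 1 / (1 - x)) / (n j : ℝ)) atTop (𝓝 0) :=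
    tendsto_const_nhds.div_atTop (tendsto_natCast_atTop_atTop.comp hn.tendsto_atTop)
  refine squeeze_zero' (Eventually.of_forall fun _ => norm_nonneg _) ?_ h0
  obtain ⟨j₀, hj⟩ := hr
  filter_upwards [eventually_ge_atTop j₀, hn.tendsto_atTop.eventually_ne_atTop 0] with j h1 h2
  exact abs_sin_mul_denom_sub_le hx' h2 (hj j h1)

theorem eventually_sin_ne_zero_and_denom_ne_zero {n : ℕ → ℕ} {x : ℝ} (hn : StrictMono n)
    (hr : Regular n x) (hx : x ∈ Icc (-1 : ℝ) 1) :
    ∀ᶠ j in atTop, Real.sin (Real.pi * (n j * ((1 + x) / 2))) ≠ 0 ∧ denom (n j) x ≠ 0 := by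
  filter_upwards [(tendsto_sin_mul_denom hn hr hx).eventually_ne (by positivity)] with j h
  exact ⟨left_ne_zero_of_mul h, right_ne_zero_of_mul (right_ne_zero_of_mul h)⟩

theorem eventually_mul_interp_sub_eq {f g : ℝ → ℝ} {n : ℕ → ℕ} {x : ℝ} (hn : StrictMono n)
    (hr : Regular n x) (hx : x ∈ Icc (-1 : ℝ) 1)
    (hg : ∀ t ∈ Icc (-1 : ℝ) 1, f t - f x = g t * (t - x)) :
    ∀ᶠ j in atTop, (n j : ℝ) * (interp (n j) f x - f x) =
      -altNodeSum g (n j) / (1 / (n j : ℝ) * denom (n j) x) := by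
  have h := eventually_sin_ne_zero_and_denom_ne_zero hn hr hx
  obtain ⟨j₀, hj⟩ := hr
  filter_upwards [h, eventually_ge_atTop j₀, hn.tendsto_atTop.eventually_ne_atTop 0] with j h1 h2 h3
  exact mul_interp_sub_eq h3 (hj j h2) h1.2 hg

/-- The error is `(2 c / π) sin (π n (1 + x) / 2) + o(1)`. -/
theorem tendsto_mul_interp_sub_sub_sin {f g : ℝ → ℝ} {n : ℕ → ℕ} {x c : ℝ} (hn : StrictMono n)
    (hr : Regular n x) (hx : x ∈ Icc (-1 : ℝ) 1)
    (hg : ∀ t ∈ Icc (-1 : ℝ) 1, f t - f x = g t * (t - x))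
    (hc : Tendsto (fun j => -altNodeSum g (n j)) atTop (𝓝 c)) :
    Tendsto (fun j => (n j : ℝ) * (interp (n j) f x - f x) -
      2 * c / Real.pi * Real.sin (Real.pi * (n j * ((1 + x) / 2)))) atTop (𝓝 0) := by
  have hq := hc.div (tendsto_sin_mul_denom hn hr hx) (by positivity)
  have h0 := hq.sub_const (2 * c / Real.pi)
  rw [show c / (Real.pi / 2) - 2 * c / Real.pi = 0 by field_simp; ring] at h0
  have hb : IsBoundedUnder (· ≤ ·) atTop
      ((‖·‖) ∘ fun j => Real.sin (Real.pi * (n j * ((1 + x) / 2)))) :=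
    isBoundedUnder_of ⟨1, fun j => Real.abs_sin_le_one _⟩
  refine (h0.zero_mul_isBoundedUnder_le hb).congr' ?_
  filter_upwards [eventually_sin_ne_zero_and_denom_ne_zero hn hr hx,
    eventually_mul_interp_sub_eq hn hr hx hg] with j h1 h2
  rw [h2, Pi.div_apply, sub_mul, div_mul_eq_mul_div, mul_comm (-altNodeSum g (n j)),
    mul_div_mul_left _ _ h1.1]

/-- Asymptotic boundedness rules out infinite limits in `EReal` as well. -/
theorem mem_Icc_of_tendsto_coe {e u : ℕ → ℝ} {R : ℝ} {L : EReal} (hu : ∀ j, |u j| ≤ R)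
    (heu : Tendsto (fun j => e j - u j) atTop (𝓝 0))
    (he : Tendsto (fun j => (e j : EReal)) atTop (𝓝 L)) :
    L ∈ Icc ((-R : ℝ) : EReal) (R : EReal) := by
  have hR : Tendsto (fun j => ((R + (e j - u j) : ℝ) : EReal)) atTop (𝓝 (R : EReal)) := by
    refine (continuous_coe_real_ereal.tendsto _).comp ?_
    simpa using heu.const_add R
  have hR' : Tendsto (fun j => ((-R + (e j - u j) : ℝ) : EReal)) atTop (𝓝 ((-R : ℝ) : EReal)) := by
    refine (continuous_coe_real_ereal.tendsto _).comp ?_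
    simpa using heu.const_add (-R)
  constructor
  · refine le_of_tendsto_of_tendsto' hR' he fun j => EReal.coe_le_coe_iff.2 ?_
    linarith [(abs_le.1 (hu j)).1]
  · refine le_of_tendsto_of_tendsto' he hR fun j => EReal.coe_le_coe_iff.2 ?_
    linarith [(abs_le.1 (hu j)).2]

/-! ### Limit values of `sin (π n (1 + x) / 2)` -/

/-- By compactness of the circle, density of the integer multiples of `2 π α` makes every point a
cluster point of the natural multiples. -/
theorem exists_strictMono_tendsto_sin {α : ℝ} (hα : Irrational α) (β : ℝ) {y : ℝ}
    (hy : y ∈ Icc (-1 : ℝ) 1) : ∃ φ : ℕ → ℕ, StrictMono φ ∧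
      Tendsto (fun j => Real.sin (2 * Real.pi * (φ j * α + β))) atTop (𝓝 y) := by
  have hp : Fact (0 < 2 * Real.pi) := ⟨Real.two_pi_pos⟩
  have hd : DenseRange (fun m : ℤ => m • ((2 * Real.pi * α : ℝ) : Real.Angle)) := by
    refine AddCircle.denseRange_zsmul_coe_iff.2 ?_
    rwa [mul_div_cancel_left₀ _ Real.two_pi_pos.ne']
  have hm : MapClusterPt ((Real.arcsin y - 2 * Real.pi * β : ℝ) : Real.Angle) atTop
      (fun m : ℕ => m • ((2 * Real.pi * α : ℝ) : Real.Angle)) :=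
    ((mapClusterPt_atTop_nsmul_tfae (G := AddCircle (2 * Real.pi)) _ _).out 0 3).2 (hd _)
  obtain ⟨φ, hφ, ht⟩ := hm.tendsto_subseq
  refine ⟨φ, hφ, ?_⟩
  have := (Real.Angle.continuous_sin.tendsto _).comp
    (ht.add_const ((2 * Real.pi * β : ℝ) : Real.Angle))
  rw [← Real.Angle.coe_add, sub_add_cancel, Real.Angle.sin_coe, Real.sin_arcsin hy.1 hy.2] at this
  refine this.congr fun j => ?_
  simp only [Function.comp]
  rw [← Real.Angle.coe_nsmul, ← Real.Angle.coe_add, Real.Angle.sin_coe, nsmul_eq_mul]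
  congr 1
  ring

/-- The sequence is periodic in `n` with period twice the denominator of `r`. -/
theorem finite_range_sin_pi_mul_rat (r : ℚ) :
    (range fun n : ℕ => Real.sin (Real.pi * (n * (r : ℝ)))).Finite := by
  refine ((Finset.range (2 * r.den)).finite_toSet.image
    fun n : ℕ => Real.sin (Real.pi * (n * (r : ℝ)))).subset ?_
  rintro _ ⟨n, rfl⟩
  have hpos : 0 < 2 * r.den := by have := r.den_pos; omega
  refine ⟨n % (2 * r.den), by simpa using Nat.mod_lt n hpos, ?_⟩
  have hd : (r.den : ℝ) * r = r.num := by exact_mod_cast Rat.den_mul_eq_num r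
  have hn : (n : ℝ) = (n % (2 * r.den) : ℕ) + 2 * r.den * (n / (2 * r.den) : ℕ) := by
    exact_mod_cast (Nat.mod_add_div n (2 * r.den)).symm
  dsimp only
  conv_rhs => rw [hn]
  generalize n / (2 * r.den) = q
  rw [← Real.sin_add_int_mul_two_pi _ ((q : ℤ) * r.num)]
  congr 1
  push_cast
  rw [← hd]
  ring

/-! ### Limits of the error at irrational points -/

theorem mem_irrationalLimits {f g : ℝ → ℝ} {n : ℕ → ℕ} {x c : ℝ} {L : EReal} (hn : StrictMono n)
    (hr : Regular n x) (hx : x ∈ Icc (-1 : ℝ) 1)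
    (hg : ∀ t ∈ Icc (-1 : ℝ) 1, f t - f x = g t * (t - x))
    (hc : Tendsto (fun j => -altNodeSum g (n j)) atTop (𝓝 c)) (hL : ErrorTendsto f x n L) :
    L ∈ irrationalLimits c := by
  refine mem_Icc_of_tendsto_coe (fun j => ?_) (tendsto_mul_interp_sub_sub_sin hn hr hx hg hc) hL
  rw [abs_mul, abs_div, abs_mul, abs_two, abs_of_pos Real.pi_pos]
  exact mul_le_of_le_one_right (by positivity) (Real.abs_sin_le_one _)

theorem exists_errorTendsto_of_mem_irrationalLimits {f g : ℝ → ℝ} {A : ℕ → Prop} {x c : ℝ}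
    {L : EReal} (hx : x ∈ Icc (-1 : ℝ) 1)
    (hreg : ∀ n : ℕ → ℕ, StrictMono n → Regular n x)
    (hg : ∀ t ∈ Icc (-1 : ℝ) 1, f t - f x = g t * (t - x))
    (hc : Tendsto (fun n => -altNodeSum g n) (atTop ⊓ 𝓟 {n | A n}) (𝓝 c))
    (hA : ∀ y ∈ Icc (-1 : ℝ) 1, ∃ n : ℕ → ℕ, StrictMono n ∧ (∀ j, A (n j)) ∧
      Tendsto (fun j => Real.sin (Real.pi * (n j * ((1 + x) / 2)))) atTop (𝓝 y))
    (hL : L ∈ irrationalLimits c) :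
    ∃ n : ℕ → ℕ, (StrictMono n ∧ ∀ j, A (n j)) ∧ Regular n x ∧ ErrorTendsto f x n L := by
  obtain ⟨l, rfl⟩ : ∃ l : ℝ, L = l := by
    induction L with
    | bot => exact absurd hL.1 (by simp)
    | top => exact absurd hL.2 (by simp)
    | coe l => exact ⟨l, rfl⟩
  have h1 : -(2 * |c| / Real.pi) ≤ l := EReal.coe_le_coe_iff.1 hL.1
  have h2 : l ≤ 2 * |c| / Real.pi := EReal.coe_le_coe_iff.1 hL.2
  obtain ⟨y, hy, hyl⟩ : ∃ y ∈ Icc (-1 : ℝ) 1, 2 * c / Real.pi * y = l := by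
    -- for `c = 0` the interval is `{0}` and every `y` will do
    rcases eq_or_ne c 0 with rfl | hc0
    · refine ⟨0, by norm_num, ?_⟩
      simp at h1 h2 ⊢
      linarith
    · have hb : 2 * c / Real.pi ≠ 0 := by positivity
      refine ⟨l / (2 * c / Real.pi), ?_, mul_div_cancel₀ _ hb⟩
      rw [mem_Icc, ← abs_le, abs_div, div_le_one (abs_pos.2 hb), abs_div, abs_mul, abs_two,
        abs_of_pos Real.pi_pos]
      exact abs_le.2 ⟨h1, h2⟩
  obtain ⟨n, hn, hAn, ht⟩ := hA y hy
  refine ⟨n, ⟨hn, hAn⟩, hreg n hn, ?_⟩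
  have hc' := hc.comp (tendsto_inf.2 ⟨hn.tendsto_atTop,
    tendsto_principal.2 (Eventually.of_forall hAn)⟩)
  have := (tendsto_mul_interp_sub_sub_sin hn (hreg n hn) hx hg hc').add
    (ht.const_mul (2 * c / Real.pi))
  rw [zero_add, hyl] at this
  refine (continuous_coe_real_ereal.tendsto _).comp (this.congr fun j => ?_)
  ring

theorem regular_of_irrational {x : ℝ} (hx : Irrational x) (n : ℕ → ℕ) : Regular n x := by
  refine ⟨0, fun j _ ⟨k, _, hk⟩ => hx ⟨2 * k / n j - 1, ?_⟩⟩
  rw [hk, node]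
  push_cast
  rfl

/-! ### Limits of the error at rational points -/

/-- The possible limits of `D_n(x)/n` at the point `x = 2 r - 1`, that is, the numbers
`π / (2 σ)` for `σ` a nonzero value of `sin (π n r)`. -/
def denomLimitCandidates (r : ℚ) : Set ℝ :=
  (fun σ => Real.pi / 2 / σ) '' ((range fun n : ℕ => Real.sin (Real.pi * (n * (r : ℝ)))) \ {0})

/-- The sines lie in a finite set without zero, hence converge along a subsequence to a nonzero
limit, while their products with `D_n(x) / n` tend to `π / 2`. -/
theorem exists_subseq_tendsto_denom {n : ℕ → ℕ} {x : ℝ} {r : ℚ} (hxr : (1 + x) / 2 = r)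
    (hn : StrictMono n) (hr : Regular n x) (hx : x ∈ Icc (-1 : ℝ) 1) :
    ∃ y ∈ denomLimitCandidates r, ∃ φ : ℕ → ℕ, StrictMono φ ∧
      Tendsto (fun j => 1 / (n (φ j) : ℝ) * denom (n (φ j)) x) atTop (𝓝 y) := by
  have hfin : ((range fun n : ℕ => Real.sin (Real.pi * (n * (r : ℝ)))) \ {0}).Finite :=
    (finite_range_sin_pi_mul_rat r).sdiff
  have hs := eventually_sin_ne_zero_and_denom_ne_zero hn hr hx
  have ht := tendsto_sin_mul_denom hn hr hx
  rw [hxr] at hs ht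
  obtain ⟨σ, hσ, φ, hφ, hlim⟩ := hfin.isCompact.tendsto_subseq'
    (x := fun j => Real.sin (Real.pi * (n j * (r : ℝ))))
    (hs.mono fun j hj => ⟨mem_range_self _, hj.1⟩).frequently
  refine ⟨_, mem_image_of_mem _ hσ, φ, hφ, ?_⟩
  refine ((ht.comp hφ.tendsto_atTop).div hlim hσ.2).congr' ?_
  filter_upwards [hφ.tendsto_atTop.eventually hs] with j hj
  exact mul_div_cancel_left₀ _ hj.1

theorem ne_zero_of_mem_denomLimitCandidates {r : ℚ} {y : ℝ} (hy : y ∈ denomLimitCandidates r) :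
    y ≠ 0 := by
  obtain ⟨σ, hσ, rfl⟩ := hy
  exact div_ne_zero (by positivity) hσ.2

theorem Regular.comp {n φ : ℕ → ℕ} {x : ℝ} (hr : Regular n x) (hφ : StrictMono φ) :
    Regular (n ∘ φ) x := by
  obtain ⟨j₀, hj⟩ := hr
  exact ⟨j₀, fun j h => hj _ (h.trans hφ.le_apply)⟩

theorem mem_denomLimitCandidates {n : ℕ → ℕ} {x : ℝ} {r : ℚ} {y : EReal}
    (hxr : (1 + x) / 2 = r) (hn : StrictMono n) (hr : Regular n x) (hx : x ∈ Icc (-1 : ℝ) 1)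
    (hy : DenomTendsto x n y) : ∃ z ∈ denomLimitCandidates r, y = (z : EReal) := by
  obtain ⟨z, hz, φ, hφ, hlim⟩ := exists_subseq_tendsto_denom hxr hn hr hx
  exact ⟨z, hz, tendsto_nhds_unique (hy.comp hφ.tendsto_atTop)
    ((continuous_coe_real_ereal.tendsto _).comp hlim)⟩

theorem finiteNonzeroReals_denomLimits {A : ℕ → Prop} {x : ℝ} {r : ℚ} (hxr : (1 + x) / 2 = r)
    (hx : x ∈ Icc (-1 : ℝ) 1) :
    FiniteNonzeroReals {y | ∃ n : ℕ → ℕ, (StrictMono n ∧ ∀ j, A (n j)) ∧ Regular n x ∧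
      DenomTendsto x n y} := by
  constructor
  · refine (((finite_range_sin_pi_mul_rat r).sdiff (t := {0})).image
      (fun σ => Real.pi / 2 / σ)).image (fun z : ℝ => (z : EReal)) |>.subset ?_
    rintro y ⟨n, ⟨hn, -⟩, hr, hy⟩
    obtain ⟨z, hz, rfl⟩ := mem_denomLimitCandidates hxr hn hr hx hy
    exact ⟨z, hz, rfl⟩
  · rintro y ⟨n, ⟨hn, -⟩, hr, hy⟩
    obtain ⟨z, hz, rfl⟩ := mem_denomLimitCandidates hxr hn hr hx hy
    exact ⟨z, ne_zero_of_mem_denomLimitCandidates hz, rfl⟩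

theorem errorTendsto_div {f g : ℝ → ℝ} {n : ℕ → ℕ} {x c y : ℝ} (hn : StrictMono n)
    (hr : Regular n x) (hx : x ∈ Icc (-1 : ℝ) 1)
    (hg : ∀ t ∈ Icc (-1 : ℝ) 1, f t - f x = g t * (t - x))
    (hc : Tendsto (fun j => -altNodeSum g (n j)) atTop (𝓝 c)) (hy : y ≠ 0)
    (hlim : Tendsto (fun j => 1 / (n j : ℝ) * denom (n j) x) atTop (𝓝 y)) :
    ErrorTendsto f x n ((c : EReal) / (y : EReal)) := by
  rw [ErrorTendsto, ← EReal.coe_div]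
  refine (continuous_coe_real_ereal.tendsto _).comp ?_
  refine (hc.div hlim hy).congr' ?_
  filter_upwards [eventually_mul_interp_sub_eq hn hr hx hg] with j hj
  exact hj.symm

theorem mem_rationalLimits {f g : ℝ → ℝ} {A : ℕ → Prop} {n : ℕ → ℕ} {x c : ℝ} {r : ℚ} {L : EReal}
    (hxr : (1 + x) / 2 = r) (hn : StrictMono n ∧ ∀ j, A (n j)) (hr : Regular n x)
    (hx : x ∈ Icc (-1 : ℝ) 1) (hg : ∀ t ∈ Icc (-1 : ℝ) 1, f t - f x = g t * (t - x))
    (hc : Tendsto (fun n => -altNodeSum g n) (atTop ⊓ 𝓟 {n | A n}) (𝓝 c))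
    (hL : ErrorTendsto f x n L) :
    L ∈ rationalLimits c {y | ∃ n : ℕ → ℕ, (StrictMono n ∧ ∀ j, A (n j)) ∧ Regular n x ∧
      DenomTendsto x n y} := by
  obtain ⟨y, hy, φ, hφ, hlim⟩ := exists_subseq_tendsto_denom hxr hn.1 hr hx
  have hnφ : StrictMono (n ∘ φ) := hn.1.comp hφ
  have hc' := hc.comp (tendsto_inf.2 ⟨hnφ.tendsto_atTop,
    tendsto_principal.2 (Eventually.of_forall fun j => hn.2 (φ j))⟩)
  refine ⟨y, ⟨n ∘ φ, ⟨hnφ, fun j => hn.2 (φ j)⟩, hr.comp hφ,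
    (continuous_coe_real_ereal.tendsto _).comp hlim⟩, ?_⟩
  exact tendsto_nhds_unique (errorTendsto_div hnφ (hr.comp hφ) hx hg hc'
    (ne_zero_of_mem_denomLimitCandidates hy) hlim) (hL.comp hφ.tendsto_atTop)

theorem exists_errorTendsto_of_mem_rationalLimits {f g : ℝ → ℝ} {A : ℕ → Prop} {x c : ℝ} {r : ℚ}
    {L : EReal} (hxr : (1 + x) / 2 = r) (hx : x ∈ Icc (-1 : ℝ) 1)
    (hg : ∀ t ∈ Icc (-1 : ℝ) 1, f t - f x = g t * (t - x))
    (hc : Tendsto (fun n => -altNodeSum g n) (atTop ⊓ 𝓟 {n | A n}) (𝓝 c))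
    (hL : L ∈ rationalLimits c {y | ∃ n : ℕ → ℕ, (StrictMono n ∧ ∀ j, A (n j)) ∧ Regular n x ∧
      DenomTendsto x n y}) :
    ∃ n : ℕ → ℕ, (StrictMono n ∧ ∀ j, A (n j)) ∧ Regular n x ∧ ErrorTendsto f x n L := by
  obtain ⟨_, ⟨n, hn, hr, hy⟩, rfl⟩ := hL
  obtain ⟨z, hz, rfl⟩ := mem_denomLimitCandidates hxr hn.1 hr hx hy
  have hc' := hc.comp (tendsto_inf.2 ⟨hn.1.tendsto_atTop,
    tendsto_principal.2 (Eventually.of_forall hn.2)⟩)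
  exact ⟨n, hn, hr, errorTendsto_div hn.1 hr hx hg hc' (ne_zero_of_mem_denomLimitCandidates hz)
    ((EReal.isEmbedding_coe.tendsto_nhds_iff).2 hy)⟩

/-! ### Odd and even degrees -/

theorem exists_odd_tendsto_sin {x : ℝ} (hx : Irrational x) {y : ℝ} (hy : y ∈ Icc (-1 : ℝ) 1) :
    ∃ n : ℕ → ℕ, StrictMono n ∧ (∀ j, Odd (n j)) ∧
      Tendsto (fun j => Real.sin (Real.pi * (n j * ((1 + x) / 2)))) atTop (𝓝 y) := by
  have hα : Irrational ((1 + x) / 2) := by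
    simpa using (hx.natCast_add 1).div_natCast two_ne_zero
  -- `(2 m + 1) (1 + x) / 2 = 2 (m (1 + x) / 2 + (1 + x) / 4)`
  obtain ⟨φ, hφ, ht⟩ := exists_strictMono_tendsto_sin hα ((1 + x) / 4) hy
  refine ⟨fun j => 2 * φ j + 1, fun i j hij => ?_, fun j => ⟨φ j, rfl⟩, ht.congr fun j => ?_⟩
  · have := hφ hij
    dsimp only
    omega
  · congr 1
    push_cast
    ring

theorem exists_even_tendsto_sin {x : ℝ} (hx : Irrational x) {y : ℝ} (hy : y ∈ Icc (-1 : ℝ) 1) :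
    ∃ n : ℕ → ℕ, StrictMono n ∧ (∀ j, Even (n j)) ∧
      Tendsto (fun j => Real.sin (Real.pi * (n j * ((1 + x) / 2)))) atTop (𝓝 y) := by
  have hα : Irrational ((1 + x) / 2) := by
    simpa using (hx.natCast_add 1).div_natCast two_ne_zero
  obtain ⟨φ, hφ, ht⟩ := exists_strictMono_tendsto_sin hα 0 hy
  refine ⟨fun j => 2 * φ j, fun i j hij => ?_, fun j => even_two_mul _, ht.congr fun j => ?_⟩
  · have := hφ hij
    dsimp only
    omega
  · congr 1
    push_cast
    ring

theorem exists_divided_difference {f : ℝ → ℝ} (hf : AC1 f) {x : ℝ} (hx : x ∈ Icc (-1 : ℝ) 1) :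
    ∃ g : ℝ → ℝ, AbsolutelyContinuousOnInterval g (-1) 1 ∧
      ∀ t ∈ Icc (-1 : ℝ) 1, f t - f x = g t * (t - x) := by
  have h11 : (-1 : ℝ) ≤ 1 := by norm_num
  refine ⟨segmentMean (derivWithin f (Icc (-1) 1)) x,
    absolutelyContinuousOnInterval_segmentMean h11 hf.2 hx, fun t ht => ?_⟩
  refine sub_eq_segmentMean_mul hf.1 ?_ hx ht
  simpa [uIcc_of_le h11] using hf.2.continuousOn

theorem tendsto_neg_altNodeSum_odd {f g : ℝ → ℝ} {x : ℝ} (hx : x ∈ Ioo (-1 : ℝ) 1)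
    (hg : AbsolutelyContinuousOnInterval g (-1) 1)
    (hfg : ∀ t ∈ Icc (-1 : ℝ) 1, f t - f x = g t * (t - x)) :
    Tendsto (fun n => -altNodeSum g n) (atTop ⊓ 𝓟 {n | Odd n}) (𝓝 (oddBias f x)) := by
  have h1 := hfg 1 (by norm_num)
  have h2 := hfg (-1) (by norm_num)
  have hx1 : x - 1 ≠ 0 := by linarith [hx.2]
  have hx2 : x + 1 ≠ 0 := by linarith [hx.1]
  have e : oddBias f x = -((g (-1) - g 1) / 2) := by
    rw [oddBias, ← neg_sub (f 1), ← neg_sub (f (-1)), h1, h2]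
    field_simp
    ring
  rw [e]
  exact (tendsto_altNodeSum_of_odd hg).neg

theorem tendsto_neg_altNodeSum_even {f g : ℝ → ℝ} {x : ℝ} (hx : x ∈ Ioo (-1 : ℝ) 1)
    (hg : AbsolutelyContinuousOnInterval g (-1) 1)
    (hfg : ∀ t ∈ Icc (-1 : ℝ) 1, f t - f x = g t * (t - x)) :
    Tendsto (fun n => -altNodeSum g n) (atTop ⊓ 𝓟 {n | Even n}) (𝓝 (evenBias f x)) := by
  have h1 := hfg 1 (by norm_num)
  have h2 := hfg (-1) (by norm_num)
  have hx1 : x - 1 ≠ 0 := by linarith [hx.2]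
  have hx2 : x + 1 ≠ 0 := by linarith [hx.1]
  have e : evenBias f x = -((g (-1) + g 1) / 2) := by
    rw [evenBias, h1, h2]
    field_simp
    ring
  rw [e]
  exact (tendsto_altNodeSum_of_even hg).neg

/-- Both inclusions at an irrational point, for the degrees singled out by `A`. -/
theorem irrational_limit_set {f g : ℝ → ℝ} {A : ℕ → Prop} {x c : ℝ} (hxi : Irrational x)
    (hx : x ∈ Icc (-1 : ℝ) 1) (hg : ∀ t ∈ Icc (-1 : ℝ) 1, f t - f x = g t * (t - x))
    (hc : Tendsto (fun n => -altNodeSum g n) (atTop ⊓ 𝓟 {n | A n}) (𝓝 c))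
    (hA : ∀ y ∈ Icc (-1 : ℝ) 1, ∃ n : ℕ → ℕ, StrictMono n ∧ (∀ j, A (n j)) ∧
      Tendsto (fun j => Real.sin (Real.pi * (n j * ((1 + x) / 2)))) atTop (𝓝 y)) :
    (∀ (n : ℕ → ℕ) (L : EReal), (StrictMono n ∧ ∀ j, A (n j)) → ErrorTendsto f x n L →
      L ∈ irrationalLimits c) ∧
    ∀ L ∈ irrationalLimits c, ∃ n : ℕ → ℕ, (StrictMono n ∧ ∀ j, A (n j)) ∧ Regular n x ∧
      ErrorTendsto f x n L :=
  ⟨fun n _ hn hL => mem_irrationalLimits hn.1 (regular_of_irrational hxi n) hx hg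
      (hc.comp (tendsto_inf.2 ⟨hn.1.tendsto_atTop,
        tendsto_principal.2 (Eventually.of_forall hn.2)⟩)) hL,
    fun _ hL => exists_errorTendsto_of_mem_irrationalLimits hx
      (fun n _ => regular_of_irrational hxi n) hg hc hA hL⟩

/-- The assertions at a rational point, for the degrees singled out by `A`. The limit of the
alternating sums is only required at interior points: at `±1` the bias is a junk value, but there
is no regular sequence. For `A = Odd` and `A = Even` the set of limits of `D_n(x) / n` is, by
definition, `oddDenomLimits x` and `evenDenomLimits x`. -/
theorem rational_limit_set {f g : ℝ → ℝ} {A : ℕ → Prop} {x c : ℝ} {r : ℚ}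
    (hxr : (1 + x) / 2 = r) (hx : x ∈ Icc (-1 : ℝ) 1)
    (hg : ∀ t ∈ Icc (-1 : ℝ) 1, f t - f x = g t * (t - x))
    (hc : x ∈ Ioo (-1 : ℝ) 1 →
      Tendsto (fun n => -altNodeSum g n) (atTop ⊓ 𝓟 {n | A n}) (𝓝 c)) :
    FiniteNonzeroReals {y | ∃ n : ℕ → ℕ, (StrictMono n ∧ ∀ j, A (n j)) ∧ Regular n x ∧
      DenomTendsto x n y} ∧
    (∀ (n : ℕ → ℕ) (L : EReal), (StrictMono n ∧ ∀ j, A (n j)) → Regular n x →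
      ErrorTendsto f x n L →
      L ∈ rationalLimits c {y | ∃ n : ℕ → ℕ, (StrictMono n ∧ ∀ j, A (n j)) ∧ Regular n x ∧
        DenomTendsto x n y}) ∧
    ∀ L ∈ rationalLimits c {y | ∃ n : ℕ → ℕ, (StrictMono n ∧ ∀ j, A (n j)) ∧ Regular n x ∧
        DenomTendsto x n y},
      ∃ n : ℕ → ℕ, (StrictMono n ∧ ∀ j, A (n j)) ∧ Regular n x ∧ ErrorTendsto f x n L := by
  refine ⟨finiteNonzeroReals_denomLimits hxr hx, fun n L hn hr hL =>
    mem_rationalLimits hxr hn hr hx hg (hc (hr.mem_Ioo hn.1 hx)) hL, fun L hL => ?_⟩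
  have hx' : x ∈ Ioo (-1 : ℝ) 1 := by
    obtain ⟨_, ⟨n, hn, hr, -⟩, -⟩ := hL
    exact hr.mem_Ioo hn.1 hx
  exact exists_errorTendsto_of_mem_rationalLimits hxr hx hg (hc hx') hL

end Berrut

theorem mainTheorem1 (f : ℝ → ℝ) (hf : Berrut.AC1 f) (x : ℝ) (hx : x ∈ Set.Icc (-1 : ℝ) 1) :
    -- irrational points
    (Irrational x →
      ((∀ (n : ℕ → ℕ) (L : EReal), Berrut.OddSeq n → Berrut.ErrorTendsto f x n L →
          L ∈ Berrut.irrationalLimits (Berrut.oddBias f x)) ∧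
        (∀ L ∈ Berrut.irrationalLimits (Berrut.oddBias f x),
          ∃ n : ℕ → ℕ, Berrut.OddSeq n ∧ Berrut.Regular n x ∧ Berrut.ErrorTendsto f x n L)) ∧
      ((∀ (n : ℕ → ℕ) (L : EReal), Berrut.EvenSeq n → Berrut.ErrorTendsto f x n L →
          L ∈ Berrut.irrationalLimits (Berrut.evenBias f x)) ∧
        (∀ L ∈ Berrut.irrationalLimits (Berrut.evenBias f x),
          ∃ n : ℕ → ℕ, Berrut.EvenSeq n ∧ Berrut.Regular n x ∧ Berrut.ErrorTendsto f x n L))) ∧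
    -- rational points
    (¬ Irrational x →
      (Berrut.FiniteNonzeroReals (Berrut.oddDenomLimits x) ∧
        (∀ (n : ℕ → ℕ) (L : EReal), Berrut.OddSeq n → Berrut.Regular n x →
          Berrut.ErrorTendsto f x n L →
          L ∈ Berrut.rationalLimits (Berrut.oddBias f x) (Berrut.oddDenomLimits x)) ∧
        (∀ L ∈ Berrut.rationalLimits (Berrut.oddBias f x) (Berrut.oddDenomLimits x),
          ∃ n : ℕ → ℕ, Berrut.OddSeq n ∧ Berrut.Regular n x ∧ Berrut.ErrorTendsto f x n L)) ∧
      (Berrut.FiniteNonzeroReals (Berrut.evenDenomLimits x) ∧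
        (∀ (n : ℕ → ℕ) (L : EReal), Berrut.EvenSeq n → Berrut.Regular n x →
          Berrut.ErrorTendsto f x n L →
          L ∈ Berrut.rationalLimits (Berrut.evenBias f x) (Berrut.evenDenomLimits x)) ∧
        (∀ L ∈ Berrut.rationalLimits (Berrut.evenBias f x) (Berrut.evenDenomLimits x),
          ∃ n : ℕ → ℕ, Berrut.EvenSeq n ∧ Berrut.Regular n x ∧ Berrut.ErrorTendsto f x n L))) := by
  obtain ⟨g, hg, hfg⟩ := Berrut.exists_divided_difference hf hx
  refine ⟨fun hxi => ?_, fun hxq => ?_⟩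
  · have hx' := (Berrut.regular_of_irrational hxi id).mem_Ioo strictMono_id hx
    exact ⟨Berrut.irrational_limit_set hxi hx hfg (Berrut.tendsto_neg_altNodeSum_odd hx' hg hfg)
        fun _ => Berrut.exists_odd_tendsto_sin hxi,
      Berrut.irrational_limit_set hxi hx hfg (Berrut.tendsto_neg_altNodeSum_even hx' hg hfg)
        fun _ => Berrut.exists_even_tendsto_sin hxi⟩
  · obtain ⟨q, hq⟩ := exists_rat_of_not_irrational hxq
    have hxr : (1 + x) / 2 = ((1 + q) / 2 : ℚ) := by
      rw [hq]
      push_cast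
      rfl
    exact ⟨Berrut.rational_limit_set hxr hx hfg
        fun hx' => Berrut.tendsto_neg_altNodeSum_odd hx' hg hfg,
      Berrut.rational_limit_set hxr hx hfg
        fun hx' => Berrut.tendsto_neg_altNodeSum_even hx' hg hfg⟩
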